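/- A system of $d$ commuting transformations $\mathbf X=(X,\mathscr A,\mu,T_1,\dots,T_d)$ consists of a standard Borel probability space $(X,\mathscr A,\mu)$ and $d$ pairwise commuting, invertible, $\mu$-preserving transformations $T_1,\dots,T_d$ of $X$. For such a system (with $d\ge 2$) and a $\mu$-preserving transformation $S$ of $X$ put $$\mathscr I^{S}=\{A\in\mathscr A:\ \mu(A\,\Delta\, S^{-1}A)=0\},\qquad \mathbf X_{\mathscr C}=\mathscr I^{T_1}\vee\mathscr I^{T_2T_1^{-1}}\vee\dots\vee\mathscr I^{T_dT_1^{-1}}.$$ The system $\mathbf X$ is a $\mathscr C$-system if $\mathscr A=\mathbf X_{\mathscr C}$. A joining of $\mathbf X$ with a system $\mathbf Y=(Y,\mathscr B,\nu,S_1,\dots,S_d)$ is a probability measure $\lambda$ on $X\times Y$ with marginals $\mu$ and $\nu$ that is invariant under $T_i\times S_i$ for $i=1,\dots,d$. The system $\mathbf X$ is $\mathscr C$-sated if for every joining $\lambda$ of $\mathbf X$ with a $\mathscr C$-system $\mathbf Y$ and every bounded measurable function $f$ on $X$, $$\mathbb E_\lambda[f(x)\mid \mathbf Y]=\mathbb E_\lambda\bigl[\,\mathbb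 E_{\mu}[f\mid \mathbf X_{\mathscr C}](x)\bigm| \mathbf Y\,\bigr]\qquad \lambda\text{-almost everywhere},$$ where conditioning on $\mathbf Y$ means conditioning on the $\sigma$-algebra generated by the second coordinate. **Proposition.** Let $d\ge 2$. Assume that for every system $(X,\mathscr A,\mu,T_1,\dots,T_{d-1})$ of $d-1$ commuting transformations and all $f_1,\dots,f_{d-1}\in L^\infty(\mu)$ the averages $$\frac1N\sum_{n=1}^N f_1\circ T_1^n\cdots f_{d-1}\circ T_{d-1}^n$$ converge in $L^2(\mu)$ as $N\to\infty$. Then for every $\mathscr C$-sated system $(X,\mathscr A,\mu,T_1,\dots,T_d)$ of $d$ commuting transformations and all $f_1,\dots,f_d\in L^\infty(\mu)$ the averages $$\frac1N\sum_{n=1}^N f_1\circ T_1^n\cdots f_d\circ T_d^n$$ converge in $L^2(\mu)$ as $N\to\infty$. -/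

import Mathlib

open MeasureTheory Filter Topology
open scoped ENNReal

universe u

/-- `T 0, …, T (d-1)` are commuting invertible transformations of `X` preserving `μ`.
Invertible transformations of a Borel space are measurable bijections with measurable inverse. -/
structure IsCommutingSystem {d : ℕ} {X : Type u} [MeasurableSpace X] (μ : Measure X)
    (T : Fin d → X ≃ᵐ X) : Prop where
  measurePreserving : ∀ i, MeasurePreserving (T i) μ μ
  commute : ∀ i j x, T i (T j x) = T j (T i x)

/-- The average `(1/N) ∑_{n=1}^N f₁ ∘ T₁ⁿ ⋯ f_d ∘ T_dⁿ`. -/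
noncomputable def multipleAverage {d : ℕ} {X : Type u} [MeasurableSpace X]
    (T : Fin d → X ≃ᵐ X) (f : Fin d → X → ℂ) (N : ℕ) (x : X) : ℂ :=
  (1 / (N : ℂ)) * ∑ n ∈ Finset.Icc 1 N, ∏ i, f i ((T i)^[n] x)

/-- For all `f₁, …, f_d ∈ L^∞(μ)` the multiple ergodic averages converge in `L²(μ)`. -/
def MultipleAveragesConverge {d : ℕ} {X : Type u} [MeasurableSpace X] (μ : Measure X)
    (T : Fin d → X ≃ᵐ X) : Prop :=
  ∀ f : Fin d → X → ℂ, (∀ i, MemLp (f i) ∞ μ) →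
    ∃ g : X → ℂ, MemLp g 2 μ ∧
      Tendsto (fun N : ℕ => eLpNorm (multipleAverage T f N - g) 2 μ) atTop (𝓝 0)

/-- The statement of the multiple ergodic theorem for `d` commuting transformations. -/
def MultipleErgodicTheorem (d : ℕ) : Prop :=
  ∀ (X : Type u) [MeasurableSpace X] [StandardBorelSpace X]
    (μ : Measure X) [IsProbabilityMeasure μ] (T : Fin d → X ≃ᵐ X),
    IsCommutingSystem μ T → MultipleAveragesConverge μ T

/-- The isotropy σ-algebra `{A ∈ 𝒜 : μ (A ∆ T⁻¹ A) = 0}` of a transformation `T`. -/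
def isotropy {X : Type u} [MeasurableSpace X] (μ : Measure X) (T : X → X) :
    MeasurableSpace X where
  MeasurableSet' A := MeasurableSet A ∧ μ (symmDiff A (T ⁻¹' A)) = 0
  measurableSet_empty := by simp
  measurableSet_compl A hA := by
    refine ⟨hA.1.compl, ?_⟩
    rw [measure_symmDiff_eq_zero_iff] at *
    exact hA.2.compl
  measurableSet_iUnion A hA := by
    refine ⟨MeasurableSet.iUnion fun n => (hA n).1, ?_⟩
    rw [measure_symmDiff_eq_zero_iff, Set.preimage_iUnion]
    exact Filter.EventuallyEq.countable_iUnion fun n =>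
      (measure_symmDiff_eq_zero_iff).1 (hA n).2

/-- The σ-algebra `I^{T₁} ∨ I^{T₂ T₁⁻¹} ∨ ⋯ ∨ I^{T_d T₁⁻¹}`, the largest `𝒞`-factor. The
transformation `T₁` of the mathematical notation is `T 0`. -/
def largestCFactor {d : ℕ} [NeZero d] {X : Type u} [MeasurableSpace X] (μ : Measure X)
    (T : Fin d → X ≃ᵐ X) : MeasurableSpace X :=
  isotropy μ (T 0) ⊔ ⨆ (i : Fin d) (_ : i ≠ 0), isotropy μ (fun x => T i ((T 0).symm x))

/-- `𝒞`-systems: the whole σ-algebra is `I^{T₁} ∨ I^{T₂ T₁⁻¹} ∨ ⋯ ∨ I^{T_d T₁⁻¹}`. Null sets of the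
whole σ-algebra belong to every isotropy σ-algebra, so equality and equality modulo null sets
coincide. -/
def IsCSystem {d : ℕ} [NeZero d] {X : Type u} [mX : MeasurableSpace X] (μ : Measure X)
    (T : Fin d → X ≃ᵐ X) : Prop :=
  IsCommutingSystem μ T ∧ mX = largestCFactor μ T

/-- `ρ` is a joining of the systems `(X, μ, T)` and `(Y, ν, S)`. -/
structure IsJoining {d : ℕ} {X Y : Type u} [MeasurableSpace X] [MeasurableSpace Y]
    (μ : Measure X) (T : Fin d → X ≃ᵐ X) (ν : Measure Y) (S : Fin d → Y ≃ᵐ Y)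
    (ρ : Measure (X × Y)) : Prop where
  map_fst : ρ.map Prod.fst = μ
  map_snd : ρ.map Prod.snd = ν
  measurePreserving : ∀ i, MeasurePreserving (Prod.map (T i) (S i)) ρ ρ

/-- `𝒞`-sated systems: for every joining `ρ` with a `𝒞`-system `Y` and every bounded measurable `f`
on `X`, `E_ρ[f(x) | Y] = E_ρ[E_X[f | X_𝒞](x) | Y]`. -/
def IsCSated {d : ℕ} [NeZero d] {X : Type u} [MeasurableSpace X] (μ : Measure X)
    (T : Fin d → X ≃ᵐ X) : Prop :=
  ∀ (Y : Type u) [mY : MeasurableSpace Y] [StandardBorelSpace Y]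
    (ν : Measure Y) [IsProbabilityMeasure ν] (S : Fin d → Y ≃ᵐ Y), IsCSystem ν S →
    ∀ ρ : Measure (X × Y), IsJoining μ T ν S ρ →
    ∀ f : X → ℂ, Measurable f → (∃ C : ℝ, ∀ x, ‖f x‖ ≤ C) →
      ρ[fun z => f z.1 | MeasurableSpace.comap Prod.snd mY] =ᵐ[ρ]
        ρ[fun z => (μ[f | largestCFactor μ T]) z.1 | MeasurableSpace.comap Prod.snd mY]

/-! Write T_0, …, T_k for the transformations and split the first function into its conditional
expectation g on the factor `largestCFactor` and a remainder with conditional expectation zero.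

For g, linearity and L²-approximation reduce to products of indicators of sets B_0 ∈ I^{T_0} and B_j
∈ I^{T_j T_0⁻¹}. Almost everywhere 1_{B_0} ∘ T_0ⁿ = 1_{B_0} and 1_{B_j} ∘ T_0ⁿ = 1_{B_j} ∘ T_jⁿ, so
T_0 disappears and the averages for T_1, …, T_k, which converge by hypothesis, remain
(`convergesInL2_cons_prod_indicator`).

For the remainder the averages A_N tend to zero. Expanding one factor of ∫ |A_N|² gives the mean
over n of ∫ f_0(T_0ⁿ x) ∏ f_j(T_jⁿ x) conj(A_N(x)) dμ. This is an integral against the averaged law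
of the orbit points together with the function g ↦ conj(A_N(g • x)) on the group generated by T_1,
…, T_k. A weak limit of these laws is a joining with a system on `DualSpace`, which is a 𝒞-system
(`isCSystem_dualSystem`). Satedness makes f_0 orthogonal to every bounded function on that system,
so the limit of ∫ |A_N|² is zero. Passing to the weak limit needs continuous data, which a suitable
Polish topology provides. -/

/-! ### Polish topologies making the data continuous -/

section PolishModel

/-- A Polish topology can be refined so that countably many given measurable self-maps become
continuous from the finer to the original topology. -/
theorem exists_polish_le_forall_continuous {X ι : Type*} [Countable ι] [mX : MeasurableSpace X]
    (t : TopologicalSpace X) (hP : PolishSpace X) (hB : BorelSpace X)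
    (F : ι → X → X) (hF : ∀ i, Measurable (F i)) :
    ∃ t' : TopologicalSpace X, t' ≤ t ∧ @PolishSpace X t' ∧ @BorelSpace X t' mX ∧
      ∀ i, Continuous[t', t] (F i) := by
  have hm : Measurable (fun x i => F i x) := measurable_pi_lambda _ hF
  obtain ⟨t', ht', hc, hP'⟩ := hm.exists_continuous
  refine ⟨t', ht', hP', ⟨?_⟩, fun i => ?_⟩
  · rw [hB.measurable_eq, borel_eq_borel_of_le hP' hP ht']
  · exact @Continuous.comp X (ι → X) X t' (@Pi.topologicalSpace ι (fun _ => X) fun _ => t) t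
      _ _ (@continuous_apply ι (fun _ => X) (fun _ => t) i) hc

/-- Countably many measurable self-maps of a standard Borel space, together with a measurable map
to a second countable space, are continuous for some compatible Polish topology. -/
theorem exists_polish_forall_continuous {X ι Z : Type*} [Countable ι] [mX : MeasurableSpace X]
    [StandardBorelSpace X] (F : ι → X → X) (hF : ∀ i, Measurable (F i))
    [TopologicalSpace Z] [SecondCountableTopology Z] [MeasurableSpace Z] [OpensMeasurableSpace Z]
    (φ : X → Z) (hφ : Measurable φ) :
    ∃ t : TopologicalSpace X, @PolishSpace X t ∧ @BorelSpace X t mX ∧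
      (∀ i, Continuous[t, t] (F i)) ∧ Continuous[t, _] φ := by
  obtain ⟨t₀, hB₀, hP₀⟩ := StandardBorelSpace.polish (α := X)
  obtain ⟨t₁, ht₁, hφ₁, hP₁⟩ := hφ.exists_continuous
  have hB₁ : @BorelSpace X t₁ mX := ⟨by rw [hB₀.measurable_eq, borel_eq_borel_of_le hP₁ hP₀ ht₁]⟩
  let P := {t : TopologicalSpace X // @PolishSpace X t ∧ @BorelSpace X t mX}
  choose! next hle hPn hBn hcn using fun t : P =>
    exists_polish_le_forall_continuous t.1 t.2.1 t.2.2 F hF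
  -- Each refinement gives continuity only from the finer topology to the coarser one. Iterating and
  -- taking the infimum of the sequence makes source and target agree.
  let s : ℕ → P := fun n => Nat.rec ⟨t₁, hP₁, hB₁⟩ (fun _ t => ⟨next t, hPn t, hBn t⟩) n
  have hs : ∀ n, (s (n + 1)).1 ≤ (s n).1 := fun n => hle (s n)
  have hanti : Antitone fun n => (s n).1 := antitone_nat_of_succ_le hs
  have hPol : @PolishSpace X (⨅ n, (s n).1) :=
    PolishSpace.iInf ⟨0, fun n => hanti (Nat.zero_le n)⟩ fun n => (s n).2.1
  have hBor : @BorelSpace X (⨅ n, (s n).1) mX := by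
    refine @BorelSpace.mk X (⨅ n, (s n).1) mX ?_
    exact hB₁.measurable_eq.trans
      (borel_eq_borel_of_le hPol hP₁ (iInf_le (fun n => (s n).1) 0)).symm
  refine ⟨⨅ n, (s n).1, hPol, hBor, fun i => ?_, ?_⟩
  · refine continuous_iInf_rng.2 fun n => ?_
    exact continuous_le_dom (iInf_le (fun n => (s n).1) (n + 1)) (hcn (s n) i)
  · exact continuous_le_dom (iInf_le (fun n => (s n).1) 0) hφ₁

end PolishModel

/-! ### Elementary properties of multiple averages -/

section Averages

variable {d k : ℕ} {X : Type u} [MeasurableSpace X]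

theorem norm_multipleAverage_le (T : Fin d → X ≃ᵐ X) {f : Fin d → X → ℂ} {C : ℝ} (hC : 0 ≤ C)
    (hf : ∀ i x, ‖f i x‖ ≤ C) (N : ℕ) (x : X) : ‖multipleAverage T f N x‖ ≤ C ^ d := by
  have h1 : ‖∑ n ∈ Finset.Icc 1 N, ∏ i, f i ((T i)^[n] x)‖ ≤ N * C ^ d := by
    refine (norm_sum_le_of_le (Finset.Icc 1 N) (f := fun n => ∏ i, f i ((T i)^[n] x))
      (n := fun _ => C ^ d) fun n _ => ?_).trans (by simp)
    rw [norm_prod]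
    exact (Finset.prod_le_prod (fun i _ => norm_nonneg _) fun i _ => hf i _).trans (by simp)
  rw [multipleAverage, norm_mul, norm_div, norm_one, Complex.norm_natCast]
  -- For N = 0 the convention 1 / 0 = 0 makes the average vanish.
  rcases Nat.eq_zero_or_pos N with rfl | hN
  · simp; positivity
  · have : (0 : ℝ) < N := by exact_mod_cast hN
    calc _ ≤ 1 / (N : ℝ) * (N * C ^ d) := by gcongr
      _ = _ := by field_simp

theorem Measurable.multipleAverage {T : Fin d → X ≃ᵐ X} {f : Fin d → X → ℂ}
    (hf : ∀ i, Measurable (f i)) (N : ℕ) : Measurable (multipleAverage T f N) := by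
  refine Measurable.const_mul (Finset.measurable_sum _ fun n _ =>
    Finset.measurable_prod _ fun i _ => (hf i).comp ((T i).measurable.iterate n)) _

theorem Continuous.multipleAverage [TopologicalSpace X] {T : Fin d → X ≃ᵐ X} {f : Fin d → X → ℂ}
    (hT : ∀ i, Continuous (T i)) (hf : ∀ i, Continuous (f i)) (N : ℕ) :
    Continuous (multipleAverage T f N) := by
  refine continuous_const.mul (continuous_finsetSum _ fun n _ =>
    continuous_finsetProd _ fun i _ => (hf i).comp ((hT i).iterate n))

end Averages

/-! ### The 𝒞-system on `DualSpace` -/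

section Model

variable {k : ℕ} {X G : Type u} [MeasurableSpace X] [Group G] {R : ℝ}

/-- The space carrying the `𝒞`-system that is correlated with multiple averages: `k` points of `X`
and a bounded complex function on the group `G`. -/
abbrev DualSpace (k : ℕ) (X G : Type u) (R : ℝ) : Type u :=
  (Fin k → X) × (G → Metric.closedBall (0 : ℂ) R)

/-- The diagonal action of `t` combined with the translation by `e` of functions on `G`. -/
def diagShift (t : X ≃ᵐ X) (e : G) : DualSpace k X G R ≃ᵐ DualSpace k X G R where
  toFun z := (fun i => t (z.1 i), fun g => z.2 (g * e))
  invFun z := (fun i => t.symm (z.1 i), fun g => z.2 (g * e⁻¹))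
  left_inv z := by simp
  right_inv z := by simp
  measurable_toFun := by
    refine Measurable.prodMk (measurable_pi_lambda _ fun i => ?_) (measurable_pi_lambda _ fun g => ?_)
    · exact t.measurable.comp ((measurable_pi_apply i).comp measurable_fst)
    · exact (measurable_pi_apply (g * e)).comp measurable_snd
  measurable_invFun := by
    refine Measurable.prodMk (measurable_pi_lambda _ fun i => ?_) (measurable_pi_lambda _ fun g => ?_)
    · exact t.symm.measurable.comp ((measurable_pi_apply i).comp measurable_fst)
    · exact (measurable_pi_apply (g * e⁻¹)).comp measurable_snd

/-- The product transformation on the points combined with the identity on functions on `G`. -/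
def prodShift (T : Fin k → X ≃ᵐ X) : DualSpace k X G R ≃ᵐ DualSpace k X G R where
  toFun z := (fun i => T i (z.1 i), z.2)
  invFun z := (fun i => (T i).symm (z.1 i), z.2)
  left_inv z := by simp
  right_inv z := by simp
  measurable_toFun := by
    refine Measurable.prodMk (measurable_pi_lambda _ fun i => ?_) measurable_snd
    exact (T i).measurable.comp ((measurable_pi_apply i).comp measurable_fst)
  measurable_invFun := by
    refine Measurable.prodMk (measurable_pi_lambda _ fun i => ?_) measurable_snd
    exact (T i).symm.measurable.comp ((measurable_pi_apply i).comp measurable_fst)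

/-- The transformations of the `𝒞`-system on `DualSpace`. -/
def dualSystem (T : Fin (k + 1) → X ≃ᵐ X) (e : Fin k → G) (R : ℝ) :
    Fin (k + 1) → DualSpace k X G R ≃ᵐ DualSpace k X G R :=
  Fin.cons (prodShift fun i => T i.succ) fun j => diagShift (T j.succ) (e j)

@[simp] theorem dualSystem_zero_apply (T : Fin (k + 1) → X ≃ᵐ X) (e : Fin k → G) (z) :
    dualSystem T e R 0 z = (fun i => T i.succ (z.1 i), z.2) := rfl

@[simp] theorem dualSystem_zero_symm_apply (T : Fin (k + 1) → X ≃ᵐ X) (e : Fin k → G) (z) :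
    (dualSystem T e R 0).symm z = (fun i => (T i.succ).symm (z.1 i), z.2) := rfl

@[simp] theorem dualSystem_succ_apply (T : Fin (k + 1) → X ≃ᵐ X) (e : Fin k → G) (j z) :
    dualSystem T e R j.succ z = (fun i => T j.succ (z.1 i), fun g => z.2 (g * e j)) := rfl

theorem isotropy_le {Y : Type u} [mY : MeasurableSpace Y] (ν : Measure Y) (S : Y → Y) :
    isotropy ν S ≤ mY := fun _ h => h.1

theorem largestCFactor_le {d : ℕ} [NeZero d] {Y : Type u} [mY : MeasurableSpace Y] (ν : Measure Y)
    (S : Fin d → Y ≃ᵐ Y) : largestCFactor ν S ≤ mY :=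
  sup_le (isotropy_le _ _) (iSup₂_le fun _ _ => isotropy_le _ _)

theorem comap_le_isotropy {Y Z : Type*} [mY : MeasurableSpace Y] [mZ : MeasurableSpace Z]
    (ν : Measure Y) (S : Y → Y) {p : Y → Z} (hp : Measurable p) (h : ∀ y, p (S y) = p y) :
    MeasurableSpace.comap p mZ ≤ isotropy ν S := by
  rintro _ ⟨B, hB, rfl⟩
  refine ⟨hp hB, ?_⟩
  have : S ⁻¹' (p ⁻¹' B) = p ⁻¹' B := by ext y; simp [h]
  rw [this, symmDiff_self]
  simp

/-- Transformation 0 fixes the function on G. On the i-th point it acts as T_{i+1}, exactly as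
transformation i + 1 does, so their quotient fixes that point. The coordinates are thus invariant
under the required maps, and together they generate the σ-algebra. -/
theorem isCSystem_dualSystem {T : Fin (k + 1) → X ≃ᵐ X} {e : Fin k → G}
    (hT : ∀ i j x, T i (T j x) = T j (T i x)) (he : ∀ i j, e i * e j = e j * e i)
    {ν : Measure (DualSpace k X G R)}
    (hν : ∀ i, MeasurePreserving (dualSystem T e R i) ν ν) :
    IsCSystem ν (dualSystem T e R) := by
  refine ⟨⟨hν, fun i j z => ?_⟩, le_antisymm ?_ (largestCFactor_le _ _)⟩
  · induction i using Fin.cases with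
    | zero =>
      induction j using Fin.cases with
      | zero => rfl
      | succ j => simp [hT j.succ]
    | succ i =>
      induction j using Fin.cases with
      | zero => simp [hT i.succ]
      | succ j => simp [hT i.succ j.succ, mul_assoc, he i j]
  · refine sup_le ?_ ?_
    · have hpi : MeasurableSpace.comap Prod.fst (MeasurableSpace.pi : MeasurableSpace (Fin k → X)) =
          ⨆ i, MeasurableSpace.comap (fun z : DualSpace k X G R => z.1 i) inferInstance := by
        rw [MeasurableSpace.pi, MeasurableSpace.comap_iSup]
        simp only [MeasurableSpace.comap_comp]
        rfl
      refine hpi.le.trans (iSup_le fun i => ?_)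
      refine le_trans ?_ (le_sup_of_le_right (le_iSup₂_of_le i.succ (Fin.succ_ne_zero i) le_rfl))
      refine comap_le_isotropy _ _ ((measurable_pi_apply i).comp measurable_fst) fun z => ?_
      simp
    · refine le_sup_of_le_left (comap_le_isotropy _ _ measurable_snd fun z => ?_)
      simp

end Model

/-! ### Satedness as orthogonality -/

section Sated

/-- In a joining of a `𝒞`-sated system with a `𝒞`-system `Y`, a function with vanishing conditional
expectation on the largest `𝒞`-factor is orthogonal to all functions on `Y`. -/
theorem IsCSated.integral_mul_eq_zero {d : ℕ} [NeZero d] {X Y : Type u} [MeasurableSpace X]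
    [mY : MeasurableSpace Y] [StandardBorelSpace Y] {μ : Measure X} {T : Fin d → X ≃ᵐ X}
    (hs : IsCSated μ T) {ν : Measure Y} [IsProbabilityMeasure ν] {S : Fin d → Y ≃ᵐ Y}
    (hS : IsCSystem ν S) {ρ : Measure (X × Y)} [IsProbabilityMeasure ρ] (hρ : IsJoining μ T ν S ρ)
    {f : X → ℂ} (hf : Measurable f) {C : ℝ} (hC : ∀ x, ‖f x‖ ≤ C)
    (h0 : μ[f | largestCFactor μ T] =ᵐ[μ] 0)
    {h : Y → ℂ} (hh : Measurable h) {C' : ℝ} (hC' : ∀ y, ‖h y‖ ≤ C') :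
    ∫ z, f z.1 * h z.2 ∂ρ = 0 := by
  have hle : MeasurableSpace.comap Prod.snd mY ≤ (Prod.instMeasurableSpace : MeasurableSpace (X × Y)) :=
    measurable_snd.comap_le
  have hint : Integrable (fun z : X × Y => f z.1) ρ :=
    .of_bound (hf.comp measurable_fst).aestronglyMeasurable C (ae_of_all _ fun z => hC z.1)
  have hint2 : Integrable (fun z : X × Y => f z.1 * h z.2) ρ :=
    hint.mul_bdd (c := C') (hh.comp measurable_snd).aestronglyMeasurable (ae_of_all _ fun z => hC' z.2)
  have hz : (fun z : X × Y => (μ[f | largestCFactor μ T]) z.1) =ᵐ[ρ] 0 :=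
    (MeasurePreserving.mk measurable_fst hρ.map_fst).quasiMeasurePreserving.ae_eq_comp h0
  have h1 : ρ[fun z => f z.1 | MeasurableSpace.comap Prod.snd mY] =ᵐ[ρ] 0 := by
    refine (hs Y ν S hS ρ hρ f hf ⟨C, hC⟩).trans ((condExp_congr_ae hz).trans ?_)
    rw [condExp_zero]
  have hsm : StronglyMeasurable[MeasurableSpace.comap Prod.snd mY] fun z : X × Y => h z.2 :=
    (hh.comp (comap_measurable _)).stronglyMeasurable
  -- Given the second coordinate, h factors out of the conditional expectation and f has conditional
  -- expectation zero by satedness.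
  rw [← integral_condExp hle]
  have h2 := condExp_bilin_of_stronglyMeasurable_right (μ := ρ) (ContinuousLinearMap.mul ℝ ℂ) hsm
    (f := fun z : X × Y => f z.1) hint2 hint
  rw [integral_eq_zero_of_ae]
  filter_upwards [h1, h2] with z hz1 hz2
  simp only [ContinuousLinearMap.mul_apply'] at hz2
  rw [hz2, hz1]
  simp

end Sated

/-! ### Tightness and weak limits -/

section WeakLimits

open BoundedContinuousFunction

/-- All k + 1 point marginals equal the single tight measure μ and the remaining factor is compact.
One compact set losing mass ε / (k + 1) in each coordinate therefore serves the whole family. -/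
theorem isTightMeasureSet_prod_pi {k : ℕ} {X K : Type*} [TopologicalSpace X] [PolishSpace X]
    [MeasurableSpace X] [BorelSpace X] [TopologicalSpace K] [CompactSpace K] [MeasurableSpace K]
    (μ : Measure X) [IsFiniteMeasure μ] (𝓢 : Set (Measure (X × ((Fin k → X) × K))))
    (h0 : ∀ ρ ∈ 𝓢, MeasurePreserving (fun z => z.1) ρ μ)
    (hs : ∀ ρ ∈ 𝓢, ∀ i, MeasurePreserving (fun z => z.2.1 i) ρ μ) :
    IsTightMeasureSet 𝓢 := by
  have hμ : IsTightMeasureSet {μ} := isTightMeasureSet_singleton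
  rw [isTightMeasureSet_iff_exists_isCompact_measure_compl_le] at hμ ⊢
  intro ε hε
  obtain ⟨C, hC, hCμ⟩ := hμ (ε / (k + 1)) (ENNReal.div_pos hε.ne' (by finiteness))
  replace hCμ : μ Cᶜ ≤ ε / (k + 1) := hCμ μ rfl
  refine ⟨C ×ˢ ((Set.univ.pi fun _ => C) ×ˢ Set.univ),
    hC.prod ((isCompact_univ_pi fun _ => hC).prod isCompact_univ), fun ρ hρ => ?_⟩
  have hsub : (C ×ˢ ((Set.univ.pi fun _ : Fin k => C) ×ˢ (Set.univ : Set K)))ᶜ ⊆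
      ((fun z => z.1) ⁻¹' Cᶜ) ∪ ⋃ i, (fun z => z.2.1 i) ⁻¹' Cᶜ := by
    intro z hz
    by_contra hcon
    simp only [Set.mem_union, Set.mem_preimage, Set.mem_iUnion, Set.mem_compl_iff, not_or,
      not_exists, not_not] at hcon
    exact hz ⟨hcon.1, fun i _ => hcon.2 i, trivial⟩
  have hCm : MeasurableSet Cᶜ := hC.measurableSet.compl
  calc ρ _ ≤ ρ ((fun z => z.1) ⁻¹' Cᶜ) + ∑ i, ρ ((fun z => z.2.1 i) ⁻¹' Cᶜ) :=
        (measure_mono hsub).trans ((measure_union_le _ _).trans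
          (add_le_add_right (measure_iUnion_fintype_le _ _) _))
    _ = μ Cᶜ + ∑ i : Fin k, μ Cᶜ := by
        rw [(h0 ρ hρ).measure_preimage hCm.nullMeasurableSet]
        congr 1
        exact Finset.sum_congr rfl fun i _ =>
          (hs ρ hρ i).measure_preimage hCm.nullMeasurableSet
    _ = (k + 1) * μ Cᶜ := by simp; ring
    _ ≤ (k + 1) * (ε / (k + 1)) := by gcongr
    _ ≤ ε := ENNReal.mul_div_le

/-- Prokhorov's theorem gives compact closure. Along an ultrafilter compactness alone yields a
limit, without extracting subsequences. -/
theorem exists_tendsto_of_isTight {W : Type*} [TopologicalSpace W] [T2Space W] [MeasurableSpace W]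
    [BorelSpace W] (ρ : ℕ → ProbabilityMeasure W) (U : Ultrafilter ℕ)
    (h : IsTightMeasureSet {(ν : Measure W) | ν ∈ Set.range ρ}) :
    ∃ ρ₀ : ProbabilityMeasure W, Tendsto ρ U (𝓝 ρ₀) := by
  have hc := isCompact_closure_of_isTightMeasureSet h
  obtain ⟨ρ₀, -, h₀⟩ := hc.ultrafilter_le_nhds (U.map ρ)
    (by simp only [Ultrafilter.coe_map, le_principal_iff, mem_map]
        exact Filter.Eventually.of_forall fun n => subset_closure ⟨n, rfl⟩)
  exact ⟨ρ₀, h₀⟩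

/-- A map preserves a weak limit of measures which it preserves asymptotically. -/
theorem map_eq_of_tendsto {W V : Type*} [TopologicalSpace W] [MeasurableSpace W]
    [BorelSpace W] [TopologicalSpace V] [TopologicalSpace.PseudoMetrizableSpace V]
    [MeasurableSpace V] [BorelSpace V]
    {ρ : ℕ → ProbabilityMeasure W} {U : Filter ℕ} [U.NeBot] {ρ₀ : ProbabilityMeasure W}
    (h : Tendsto ρ U (𝓝 ρ₀)) {S : W → V} (hS : Continuous S) (ν : Measure V) [IsFiniteMeasure ν]
    (hν : ∀ F : V →ᵇ ℝ, Tendsto (fun n => ∫ w, F (S w) ∂(ρ n : Measure W)) U (𝓝 (∫ v, F v ∂ν))) :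
    (ρ₀ : Measure W).map S = ν := by
  have : IsProbabilityMeasure ((ρ₀ : Measure W).map S) :=
    Measure.isProbabilityMeasure_map hS.measurable.aemeasurable
  refine ext_of_forall_integral_eq_of_IsFiniteMeasure fun F => ?_
  rw [integral_map hS.measurable.aemeasurable F.continuous.measurable.aestronglyMeasurable]
  rw [ProbabilityMeasure.tendsto_iff_forall_integral_tendsto] at h
  exact tendsto_nhds_unique (h (F.compContinuous ⟨S, hS⟩)) (hν F)

end WeakLimits

/-! ### Averaged laws -/

section Empirical

variable {X W : Type*} [MeasurableSpace X] [MeasurableSpace W]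

/-- The average of the laws of `Φ 1, …, Φ (N + 1)`. -/
noncomputable def averageLaw (μ : Measure X) (Φ : ℕ → X → W) (N : ℕ) : Measure W :=
  ((N : ℝ≥0∞) + 1)⁻¹ • ∑ n ∈ Finset.range (N + 1), μ.map (Φ (n + 1))

theorem map_averageLaw_of_forall {V : Type*} [MeasurableSpace V] {μ : Measure X} {ν : Measure V}
    {Φ : ℕ → X → W} (hΦ : ∀ n, Measurable (Φ n)) {p : W → V} (hp : Measurable p)
    (h : ∀ n, μ.map (p ∘ Φ n) = ν) (N : ℕ) : (averageLaw μ Φ N).map p = ν := by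
  rw [averageLaw, Measure.map_smul, Measure.map_finset_sum hp.aemeasurable]
  simp only [Measure.map_map hp (hΦ _), h]
  rw [Finset.sum_const, Finset.card_range, ← Nat.cast_smul_eq_nsmul ℝ≥0∞, smul_smul]
  push_cast
  rw [ENNReal.inv_mul_cancel (by simp) (by finiteness), one_smul]

theorem isProbabilityMeasure_averageLaw {μ : Measure X} [IsProbabilityMeasure μ] {Φ : ℕ → X → W}
    (hΦ : ∀ n, Measurable (Φ n)) (N : ℕ) : IsProbabilityMeasure (averageLaw μ Φ N) := by
  constructor
  -- The marginal under the map to a point records the total mass.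
  have h := map_averageLaw_of_forall (μ := μ) (ν := Measure.dirac ()) hΦ (p := fun _ => ())
    measurable_const (fun n => by
      change μ.map (fun _ => ()) = _
      rw [Measure.map_const, measure_univ, one_smul]) N
  have h2 := congrArg (fun m => m Set.univ) h
  simpa [Measure.map_apply measurable_const MeasurableSet.univ] using h2

theorem integral_averageLaw {E : Type*} [NormedAddCommGroup E] [NormedSpace ℝ E]
    {μ : Measure X} [IsProbabilityMeasure μ] {Φ : ℕ → X → W}
    (hΦ : ∀ n, Measurable (Φ n)) {F : W → E} (hF : StronglyMeasurable F) {C : ℝ}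
    (hC : ∀ w, ‖F w‖ ≤ C) (N : ℕ) :
    ∫ w, F w ∂(averageLaw μ Φ N) =
      ((N : ℝ) + 1)⁻¹ • ∑ n ∈ Finset.range (N + 1), ∫ x, F (Φ (n + 1) x) ∂μ := by
  rw [averageLaw, integral_smul_measure, integral_finsetSum_measure]
  · congr 1
    · simp
      norm_cast
    · exact Finset.sum_congr rfl fun n _ => integral_map (hΦ _).aemeasurable hF.aestronglyMeasurable
  · intro n _
    have := Measure.isProbabilityMeasure_map (μ := μ) (hΦ (n + 1)).aemeasurable
    exact .of_bound hF.aestronglyMeasurable C (ae_of_all _ hC)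

/-- Averages of bounded sequences are asymptotically shift invariant. -/
theorem norm_average_shift_sub_le {a : ℕ → ℝ} {C : ℝ} (ha : ∀ n, ‖a n‖ ≤ C) (N : ℕ) :
    ‖((N : ℝ) + 1)⁻¹ • ∑ n ∈ Finset.range (N + 1), a (n + 2) -
      ((N : ℝ) + 1)⁻¹ • ∑ n ∈ Finset.range (N + 1), a (n + 1)‖ ≤ 2 * C / ((N : ℝ) + 1) := by
  -- The difference telescopes to the two end terms, whence 2 * C.
  have h := Finset.sum_range_sub (fun n => a (n + 1)) (N + 1)
  rw [← smul_sub, ← Finset.sum_sub_distrib, h, norm_smul, norm_inv,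
    Real.norm_of_nonneg (by positivity : (0 : ℝ) ≤ N + 1), inv_mul_eq_div]
  gcongr
  exact (norm_sub_le _ _).trans (by linarith [ha (N + 1 + 1), ha (0 + 1)])

end Empirical

/-! ### Averages as correlations with the 𝒞-system -/

section Dual

open BoundedContinuousFunction

variable {k : ℕ} {X G : Type u} [MeasurableSpace X] [Group G] {R : ℝ}

theorem measurable_prod_mul_coord {f : Fin k → X → ℂ} (hf : ∀ i, Measurable (f i)) :
    Measurable fun y : DualSpace k X G R => (∏ i, f i (y.1 i)) * (y.2 (1 : G) : ℂ) :=
  (Finset.measurable_prod _ fun i _ => (hf i).comp ((measurable_pi_apply i).comp measurable_fst)).mul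
    (measurable_subtype_coe.comp ((measurable_pi_apply 1).comp measurable_snd))

omit [MeasurableSpace X] in
theorem norm_prod_mul_coord_le {f : Fin k → X → ℂ} {C : ℝ} (hC : 0 ≤ C)
    (hf : ∀ i x, ‖f i x‖ ≤ C) (y : DualSpace k X G R) :
    ‖(∏ i, f i (y.1 i)) * (y.2 (1 : G) : ℂ)‖ ≤ C ^ k * R := by
  rw [norm_mul, norm_prod]
  refine mul_le_mul ?_ (mem_closedBall_zero_iff.1 (y.2 1).2) (norm_nonneg _) (by positivity)
  exact (Finset.prod_le_prod (fun i _ => norm_nonneg _) fun i _ => hf i _).trans (by simp)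

variable [MulAction G X]

/-- The orbit point `(T₀ⁿ x, T₁ⁿ x, …, T_kⁿ x)` together with the function `g ↦ a (g • x)`. -/
def dualPoint (T : Fin (k + 1) → X ≃ᵐ X) (a : X → Metric.closedBall (0 : ℂ) R) (n : ℕ) (x : X) :
    X × DualSpace k X G R :=
  ((T 0)^[n] x, (fun i : Fin k => (T i.succ)^[n] x, fun g => a (g • x)))

theorem measurable_dualPoint {T : Fin (k + 1) → X ≃ᵐ X} {a : X → Metric.closedBall (0 : ℂ) R}
    (hG : ∀ g : G, Measurable fun x : X => g • x) (ha : Measurable a) (n : ℕ) :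
    Measurable (dualPoint (G := G) T a n) :=
  ((T 0).measurable.iterate n).prodMk ((measurable_pi_lambda _ fun i : Fin k =>
    (T i.succ).measurable.iterate n).prodMk (measurable_pi_lambda _ fun g => ha.comp (hG g)))

/-- The stored function depends on x and not on n, so advancing n moves only the points. Invariance
of the limit under transformation 0 thus becomes a shift of the averaging index. -/
theorem dualPoint_succ (T : Fin (k + 1) → X ≃ᵐ X) (e : Fin k → G)
    (a : X → Metric.closedBall (0 : ℂ) R) (n : ℕ) (x : X) :
    Prod.map (T 0) (dualSystem T e R 0) (dualPoint T a n x) = dualPoint T a (n + 1) x := by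
  simp [dualPoint, Function.iterate_succ_apply']

theorem iterate_apply_comm {T : Fin (k + 1) → X ≃ᵐ X} (hT : ∀ i j x, T i (T j x) = T j (T i x))
    (i j : Fin (k + 1)) (n : ℕ) (x : X) : (T i)^[n] (T j x) = T j ((T i)^[n] x) :=
  (Function.Commute.iterate_left (hT i j) n) x

/-- Commutation carries T_j past the iterates, and (g * e j) • x = g • (e j • x) turns right
translation into a change of base point. Invariance under these maps is then inherited from μ. -/
theorem dualPoint_apply {T : Fin (k + 1) → X ≃ᵐ X} (hT : ∀ i j x, T i (T j x) = T j (T i x))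
    {e : Fin k → G} (heT : ∀ j (x : X), e j • x = T j.succ x)
    (a : X → Metric.closedBall (0 : ℂ) R) (n : ℕ) (j : Fin k) (x : X) :
    Prod.map (T j.succ) (dualSystem T e R j.succ) (dualPoint T a n x) =
      dualPoint T a n (T j.succ x) := by
  simp only [dualPoint, Prod.map_apply, dualSystem_succ_apply, mul_smul, heT,
    iterate_apply_comm hT]

theorem sum_Icc_one_eq_sum_range {M : Type*} [AddCommMonoid M] (a : ℕ → M) (N : ℕ) :
    ∑ n ∈ Finset.Icc 1 N, a n = ∑ n ∈ Finset.range N, a (n + 1) := by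
  induction N with
  | zero => simp
  | succ N ih => rw [Finset.sum_Icc_succ_top (by omega), Finset.sum_range_succ, ih]

/-- The coordinate at 1 is the conjugate of the average and does not depend on n, while summing the
other factors over n rebuilds the average. Hence the squared norm is a correlation of f 0 with a
function on `DualSpace`. -/
theorem integral_averageLaw_mul {μ : Measure X} [IsProbabilityMeasure μ]
    {T : Fin (k + 1) → X ≃ᵐ X} (hG : ∀ g : G, Measurable fun x : X => g • x)
    {f : Fin (k + 1) → X → ℂ} (hf : ∀ i, Measurable (f i)) {C : ℝ} (hC : 0 ≤ C)
    (hfC : ∀ i x, ‖f i x‖ ≤ C) {N : ℕ} {a : X → Metric.closedBall (0 : ℂ) R} (ham : Measurable a)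
    (ha : ∀ x, (a x : ℂ) = starRingEnd ℂ (multipleAverage T f (N + 1) x)) :
    ∫ w, f 0 w.1 * ((∏ i, f (Fin.succ i) (w.2.1 i)) * (w.2.2 (1 : G) : ℂ))
      ∂(averageLaw μ (dualPoint (G := G) T a) N) =
      ((∫ x, ‖multipleAverage T f (N + 1) x‖ ^ 2 ∂μ : ℝ) : ℂ) := by
  have hm : Measurable fun w : X × DualSpace k X G R =>
      f 0 w.1 * ((∏ i, f (Fin.succ i) (w.2.1 i)) * (w.2.2 (1 : G) : ℂ)) :=
    ((hf 0).comp measurable_fst).mul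
      ((measurable_prod_mul_coord fun i => hf i.succ).comp measurable_snd)
  have hb : ∀ w : X × DualSpace k X G R,
      ‖f 0 w.1 * ((∏ i, f (Fin.succ i) (w.2.1 i)) * (w.2.2 (1 : G) : ℂ))‖ ≤ C * (C ^ k * R) :=
    fun w => (norm_mul_le _ _).trans (mul_le_mul (hfC 0 _)
      (norm_prod_mul_coord_le hC (fun i => hfC i.succ) w.2) (norm_nonneg _) hC)
  rw [integral_averageLaw (measurable_dualPoint hG ham) hm.stronglyMeasurable hb,
    ← integral_finsetSum, ← integral_smul, ← integral_complex_ofReal]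
  · refine integral_congr_ae (ae_of_all _ fun x => ?_)
    simp only [Complex.ofReal_pow, ← Complex.mul_conj', dualPoint, one_smul, ha]
    rw [← ha, Complex.real_smul]
    simp only [← mul_assoc]
    rw [← Finset.sum_mul, ← mul_assoc]
    congr 1
    rw [multipleAverage, sum_Icc_one_eq_sum_range]
    simp [Fin.prod_univ_succ]
  · intro n _
    exact .of_bound (hm.comp (measurable_dualPoint hG ham _)).aestronglyMeasurable _
      (ae_of_all _ fun x => hb _)

/-- Multiple averages tend to zero in `L²` if the first function has vanishing conditional
expectation on the largest `𝒞`-factor of a `𝒞`-sated system: the case of continuous data. -/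
theorem tendsto_integral_norm_sq_multipleAverage_of_continuous [TopologicalSpace X] [PolishSpace X]
    [BorelSpace X] [Countable G] {μ : Measure X} [IsProbabilityMeasure μ]
    {T : Fin (k + 1) → X ≃ᵐ X} (hT : IsCommutingSystem μ T) (hs : IsCSated μ T)
    (hTc : ∀ i, Continuous (T i)) (hG : ∀ g : G, Continuous fun x : X => g • x)
    {e : Fin k → G} (he : ∀ i j, e i * e j = e j * e i) (heT : ∀ j (x : X), e j • x = T j.succ x)
    {f : Fin (k + 1) → X → ℂ} (hf : ∀ i, Continuous (f i)) {C : ℝ} (hC : 0 ≤ C)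
    (hfC : ∀ i x, ‖f i x‖ ≤ C) (h0 : μ[f 0 | largestCFactor μ T] =ᵐ[μ] 0) :
    Tendsto (fun N => ∫ x, ‖multipleAverage T f (N + 1) x‖ ^ 2 ∂μ) atTop (𝓝 0) := by
  set R := C ^ (k + 1)
  let a : ℕ → X → Metric.closedBall (0 : ℂ) R := fun N x =>
    ⟨starRingEnd ℂ (multipleAverage T f (N + 1) x), by
      simpa using norm_multipleAverage_le T hC hfC (N + 1) x⟩
  have hac : ∀ N, Continuous (a N) := fun N =>
    (Complex.continuous_conj.comp (Continuous.multipleAverage hTc hf (N + 1))).subtype_mk _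
  have hΦ : ∀ N n, Measurable (dualPoint (G := G) T (a N) n) := fun N =>
    measurable_dualPoint (fun g => (hG g).measurable) (hac N).measurable
  let ρ : ℕ → ProbabilityMeasure (X × DualSpace k X G R) := fun N =>
    ⟨averageLaw μ (dualPoint T (a N)) N, isProbabilityMeasure_averageLaw (hΦ N) N⟩
  have hmp : ∀ i n, μ.map ((T i)^[n]) = μ := fun i n =>
    ((hT.measurePreserving i).iterate n).map_eq
  have hfst : ∀ N, (ρ N : Measure (X × DualSpace k X G R)).map Prod.fst = μ := fun N =>
    map_averageLaw_of_forall (hΦ N) measurable_fst (fun n => hmp 0 n) N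
  have hcoord : ∀ N i, (ρ N : Measure (X × DualSpace k X G R)).map (fun z => z.2.1 i) = μ := fun N i =>
    map_averageLaw_of_forall (hΦ N)
      ((measurable_pi_apply i).comp (measurable_fst.comp measurable_snd)) (fun n => hmp i.succ n) N
  -- The limiting joining may depend on the ultrafilter, but the limit of the squared norms along it
  -- is always zero.
  rw [tendsto_iff_ultrafilter]
  intro U hU
  have : CompactSpace (Metric.closedBall (0 : ℂ) R) :=
    isCompact_iff_compactSpace.1 (isCompact_closedBall _ _)
  obtain ⟨ρ₀, hρ₀⟩ := exists_tendsto_of_isTight ρ U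
    (isTightMeasureSet_prod_pi μ _
      (by rintro _ ⟨_, ⟨N, rfl⟩, rfl⟩; exact ⟨measurable_fst, hfst N⟩)
      (by
        rintro _ ⟨_, ⟨N, rfl⟩, rfl⟩ i
        exact ⟨(measurable_pi_apply i).comp (measurable_fst.comp measurable_snd), hcoord N i⟩))
  set S := dualSystem T e R
  have hSc : ∀ i, Continuous (S i) := by
    intro i
    induction i using Fin.cases with
    | zero =>
      refine Continuous.prodMk (continuous_pi fun i => ?_) continuous_snd
      exact (hTc i.succ).comp ((continuous_apply i).comp continuous_fst)
    | succ j =>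
      refine Continuous.prodMk (continuous_pi fun i => ?_) (continuous_pi fun g => ?_)
      · exact (hTc j.succ).comp ((continuous_apply i).comp continuous_fst)
      · exact (continuous_apply (g * e j)).comp continuous_snd
  have hPc : ∀ i, Continuous (Prod.map (T i) (S i)) := fun i => (hTc i).prodMap (hSc i)
  have hint : ∀ N (F : X × DualSpace k X G R →ᵇ ℝ), ∫ w, F w ∂(ρ N : Measure (X × DualSpace k X G R)) =
      ((N : ℝ) + 1)⁻¹ • ∑ n ∈ Finset.range (N + 1), ∫ x, F (dualPoint T (a N) (n + 1) x) ∂μ :=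
    fun N F => integral_averageLaw (hΦ N) F.continuous.measurable.stronglyMeasurable
      F.norm_coe_le_norm N
  have hPT : ∀ i, MeasurePreserving (Prod.map (T i) (S i)) (ρ₀ : Measure (X × DualSpace k X G R)) ρ₀ := by
    refine fun i => ⟨(hPc i).measurable, map_eq_of_tendsto hρ₀ (hPc i) _ fun F => ?_⟩
    have hlim := (ProbabilityMeasure.tendsto_iff_forall_integral_tendsto.1 hρ₀) F
    rw [← tendsto_sub_nhds_zero_iff] at hlim ⊢
    have key : Tendsto (fun N => ∫ w, F (Prod.map (T i) (S i) w) ∂(ρ N : Measure (X × DualSpace k X G R)) -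
        ∫ w, F w ∂(ρ N : Measure (X × DualSpace k X G R))) U (𝓝 0) := by
      have hint' := fun N => hint N (F.compContinuous ⟨_, hPc i⟩)
      simp only [compContinuous_apply, ContinuousMap.coe_mk] at hint'
      induction i using Fin.cases with
      | zero =>
        have hb : Tendsto (fun N : ℕ => 2 * ‖F‖ / ((N : ℝ) + 1)) U (𝓝 0) :=
          ((tendsto_const_div_atTop_nhds_zero_nat (2 * ‖F‖)).comp
            (tendsto_add_atTop_nat 1)).mono_left hU |>.congr fun N => by simp
        refine squeeze_zero_norm (fun N => ?_) hb
        rw [hint', hint]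
        simp only [S, dualPoint_succ]
        refine norm_average_shift_sub_le
          (a := fun n => ∫ x, F (dualPoint T (a N) n x) ∂μ) (fun n => ?_) N
        refine (norm_integral_le_of_norm_le_const (ae_of_all _ fun x =>
          F.norm_coe_le_norm _)).trans (by simp)
      | succ j =>
        -- Here invariance is exact for every N, since μ is preserved by T j.succ.
        refine tendsto_const_nhds.congr fun N => ?_
        rw [hint', hint]
        simp only [S, dualPoint_apply hT.commute heT]
        refine (sub_eq_zero.2 ?_).symm
        congr 1
        refine Finset.sum_congr rfl fun n _ => ?_
        exact (hT.measurePreserving j.succ).integral_comp (T j.succ).measurableEmbedding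
          (fun x => F (dualPoint T (a N) (n + 1) x))
    simpa using key.add hlim
  have hfst₀ : (ρ₀ : Measure (X × DualSpace k X G R)).map Prod.fst = μ := by
    refine map_eq_of_tendsto hρ₀ continuous_fst μ fun F => tendsto_const_nhds.congr fun N => ?_
    rw [← integral_map measurable_fst.aemeasurable
      F.continuous.measurable.aestronglyMeasurable, hfst N]
  set ν : Measure (DualSpace k X G R) := (ρ₀ : Measure (X × DualSpace k X G R)).map Prod.snd with hν
  have hνp : IsProbabilityMeasure ν := Measure.isProbabilityMeasure_map measurable_snd.aemeasurable
  have hνS : ∀ i, MeasurePreserving (S i) ν ν := by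
    refine fun i => ⟨(S i).measurable, ?_⟩
    rw [hν, Measure.map_map (S i).measurable measurable_snd]
    nth_rw 2 [← (hPT i).map_eq]
    rw [Measure.map_map measurable_snd (hPT i).measurable]
    rfl
  have hzero := hs.integral_mul_eq_zero (isCSystem_dualSystem hT.commute he hνS)
    ⟨hfst₀, rfl, hPT⟩ (hf 0).measurable (hfC 0) h0
    (h := fun y => (∏ i, f (Fin.succ i) (y.1 i)) * (y.2 (1 : G) : ℂ))
    (measurable_prod_mul_coord fun i => (hf i.succ).measurable)
    (norm_prod_mul_coord_le hC fun i => hfC i.succ)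
  -- The integrand is bounded and continuous, so its integrals converge to the one in the limiting
  -- joining, which is zero by `hzero`.
  have hlim := ProbabilityMeasure.tendsto_iff_forall_integral_rclike_tendsto ℂ |>.1 hρ₀
    (BoundedContinuousFunction.ofNormedAddCommGroup
      (fun w => f 0 w.1 * ((∏ i, f (Fin.succ i) (w.2.1 i)) * (w.2.2 (1 : G) : ℂ)))
      (by fun_prop) (C * (C ^ k * R)) fun w => (norm_mul_le _ _).trans (mul_le_mul (hfC 0 _)
        (norm_prod_mul_coord_le hC (fun i => hfC i.succ) w.2) (norm_nonneg _) hC))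
  simp only [BoundedContinuousFunction.coe_ofNormedAddCommGroup] at hlim
  rw [hzero] at hlim
  have hlim2 := (Complex.continuous_re.tendsto _).comp hlim
  rw [Complex.zero_re] at hlim2
  refine hlim2.congr fun N => ?_
  have := integral_averageLaw_mul (μ := μ) (T := T) (fun g : G => (hG g).measurable)
    (fun i => (hf i).measurable) hC hfC (a := a N) (hac N).measurable fun x => rfl
  rw [Function.comp_apply]
  exact (congrArg Complex.re this).trans (Complex.ofReal_re _)

end Dual

/-! ### Vanishing of the averages for measurable data -/

section Vanishing

variable {k : ℕ} {X : Type u} [MeasurableSpace X]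

/-- Multiple averages tend to zero in `L²` if the first function has vanishing conditional
expectation on the largest `𝒞`-factor of a `𝒞`-sated system. -/
theorem IsCSated.tendsto_eLpNorm_multipleAverage [StandardBorelSpace X] {μ : Measure X}
    [IsProbabilityMeasure μ] {T : Fin (k + 1) → X ≃ᵐ X} (hs : IsCSated μ T)
    (hT : IsCommutingSystem μ T) {f : Fin (k + 1) → X → ℂ} (hf : ∀ i, Measurable (f i)) {C : ℝ}
    (hC : 0 ≤ C) (hfC : ∀ i x, ‖f i x‖ ≤ C) (h0 : μ[f 0 | largestCFactor μ T] =ᵐ[μ] 0) :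
    Tendsto (fun N => eLpNorm (multipleAverage T f N) 2 μ) atTop (𝓝 0) := by
  obtain ⟨t, hP, hB, hcont, hfc⟩ := exists_polish_forall_continuous
    (Sum.elim (fun i => (T i : X → X)) fun i => ((T i).symm : X → X))
    (by rintro (i | i); exacts [(T i).measurable, (T i).symm.measurable])
    (fun x i => f i x) (measurable_pi_lambda _ hf)
  -- The acting group is the range of φ: it is countable, and its generators commute, unlike those
  -- of the free group. Induction on words, inverses included, gives continuity of the action.
  let φ : FreeGroup (Fin k) →* Equiv.Perm X := FreeGroup.lift fun j => (T j.succ).toEquiv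
  have hφc : ∀ w, Continuous (φ w) := by
    intro w
    induction w using FreeGroup.induction_on with
    | C1 => simpa using! continuous_id
    | of j => simpa [φ] using! hcont (Sum.inl j.succ)
    | inv_of j _ => simpa [φ] using! hcont (Sum.inr j.succ)
    | mul v w hv hw => simpa using! hv.comp hw
  have : Countable (FreeGroup (Fin k)) := Quot.mk_surjective.countable
  have : Countable φ.range := φ.rangeRestrict_surjective.countable
  have key := tendsto_integral_norm_sq_multipleAverage_of_continuous (G := φ.range)
    (f := f)
    (e := fun j => φ.rangeRestrict (FreeGroup.of j)) hT hs (fun i => hcont (Sum.inl i))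
    (by rintro ⟨_, w, rfl⟩; exact hφc w)
    (fun i j => by
      ext x
      simpa [φ] using! hT.commute i.succ j.succ x)
    (fun j x => by
      change φ (FreeGroup.of j) x = _
      simp [φ])
    (fun i => (continuous_apply i).comp hfc) hC hfC h0
  rw [← tendsto_add_atTop_iff_nat 1]
  have hmem : ∀ N, MemLp (multipleAverage T f N) 2 μ := fun N =>
    .of_bound (Measurable.multipleAverage hf N).aestronglyMeasurable _
      (ae_of_all _ (norm_multipleAverage_le T hC hfC N))
  -- The L² norm is the square root of the integral controlled by `key`.
  have hlim := ENNReal.tendsto_ofReal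
    ((Real.continuousAt_rpow_const 0 (2⁻¹ : ℝ) (by norm_num)).tendsto.comp key)
  simp only [Real.zero_rpow (by norm_num : (2⁻¹ : ℝ) ≠ 0), ENNReal.ofReal_zero] at hlim
  refine hlim.congr fun N => ?_
  rw [(hmem (N + 1)).eLpNorm_eq_integral_rpow_norm (by simp) (by simp)]
  simp

end Vanishing

/-! ### Convergence in L² -/

section ConvergesInL2

variable {X : Type*} [MeasurableSpace X] {μ : Measure X} {a b : ℕ → X → ℂ}

/-- Convergence of a sequence of functions in `L²(μ)`. -/
def ConvergesInL2 (μ : Measure X) (a : ℕ → X → ℂ) : Prop :=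
  ∃ g : X → ℂ, MemLp g 2 μ ∧ Tendsto (fun N => eLpNorm (a N - g) 2 μ) atTop (𝓝 0)

theorem ConvergesInL2.congr (ha : ConvergesInL2 μ a) (h : ∀ N, a N =ᵐ[μ] b N) :
    ConvergesInL2 μ b := by
  obtain ⟨g, hg, hlim⟩ := ha
  exact ⟨g, hg, hlim.congr fun N => eLpNorm_congr_ae ((h N).sub .rfl)⟩

theorem ConvergesInL2.add (ha : ConvergesInL2 μ a) (hb : ConvergesInL2 μ b)
    (ham : ∀ N, AEStronglyMeasurable (a N) μ) (hbm : ∀ N, AEStronglyMeasurable (b N) μ) :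
    ConvergesInL2 μ (fun N => a N + b N) := by
  obtain ⟨g, hg, hlim⟩ := ha
  obtain ⟨g', hg', hlim'⟩ := hb
  refine ⟨g + g', hg.add hg', tendsto_of_tendsto_of_tendsto_of_le_of_le tendsto_const_nhds
    (by simpa using hlim.add hlim') (fun _ => zero_le) fun N => ?_⟩
  simp only [add_sub_add_comm]
  exact eLpNorm_add_le ((ham N).sub hg.1) ((hbm N).sub hg'.1) (by norm_num)

theorem ConvergesInL2.bdd_mul (ha : ConvergesInL2 μ a) {h : X → ℂ} (hm : AEStronglyMeasurable h μ)
    {C : ℝ} (hC : ∀ x, ‖h x‖ ≤ C) :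
    ConvergesInL2 μ (fun N => h * a N) := by
  obtain ⟨g, hg, hlim⟩ := ha
  refine ⟨h * g, hg.of_le_mul (c := C) (hm.mul hg.1) (ae_of_all _ fun x => ?_),
    tendsto_of_tendsto_of_tendsto_of_le_of_le tendsto_const_nhds
      (by simpa using ENNReal.Tendsto.const_mul hlim (.inr (ENNReal.ofReal_ne_top (r := C))))
      (fun _ => zero_le) fun N => ?_⟩
  · simp only [Pi.mul_apply, norm_mul]
    gcongr
    exact hC x
  · refine eLpNorm_le_mul_eLpNorm_of_ae_le_mul (ae_of_all _ fun x => ?_) 2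
    simp only [Pi.mul_apply, Pi.sub_apply, ← mul_sub, norm_mul]
    gcongr
    exact hC x

/-- A sequence that can be uniformly approximated by convergent sequences converges. -/
theorem ConvergesInL2.of_approx (ha : ∀ N, MemLp (a N) 2 μ)
    (h : ∀ ε : ℝ≥0∞, 0 < ε → ∃ b : ℕ → X → ℂ, ConvergesInL2 μ b ∧
      (∀ N, AEStronglyMeasurable (b N) μ) ∧ ∀ N, eLpNorm (a N - b N) 2 μ ≤ ε) :
    ConvergesInL2 μ a := by
  have hcau : CauchySeq fun N => (ha N).toLp (a N) := by
    rw [EMetric.cauchySeq_iff']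
    intro ε hε
    -- Four errors of ε / 5 occur, and the fifth makes the bound strict. That strictness needs ε
    -- finite, so ε = ∞ is treated apart.
    have hε5 : 0 < ε / 5 := ENNReal.div_pos hε.ne' (by norm_num)
    by_cases hεt : ε = ∞
    · exact ⟨0, fun n _ => hεt ▸ edist_lt_top _ _⟩
    obtain ⟨b, ⟨g, hg, hlim⟩, hbm, hab⟩ := h (ε / 5) hε5
    obtain ⟨N, hN⟩ := eventually_atTop.1 (hlim.eventually (gt_mem_nhds hε5))
    refine ⟨N, fun n hn => ?_⟩
    rw [Lp.edist_toLp_toLp]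
    have hdist : ∀ n ≥ N, eLpNorm (a n - g) 2 μ ≤ ε / 5 + ε / 5 := fun n hn => by
      rw [← sub_add_sub_cancel (a n) (b n) g]
      exact (eLpNorm_add_le ((ha n).1.sub (hbm n)) ((hbm n).sub hg.1) (by norm_num)).trans
        (add_le_add (hab n) (hN n hn).le)
    calc eLpNorm (a n - a N) 2 μ = eLpNorm ((a n - g) - (a N - g)) 2 μ := by
          rw [sub_sub_sub_cancel_right]
      _ ≤ (ε / 5 + ε / 5) + (ε / 5 + ε / 5) :=
        (eLpNorm_sub_le ((ha n).1.sub hg.1) ((ha N).1.sub hg.1) (by norm_num)).trans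
          (add_le_add (hdist n hn) (hdist N le_rfl))
      _ = ε / 5 * 4 := by ring
      _ < ε / 5 * 5 := by
        rw [ENNReal.mul_lt_mul_iff_right hε5.ne' (ENNReal.div_ne_top hεt (by norm_num))]
        norm_num
      _ = ε := ENNReal.div_mul_cancel (by norm_num) (by norm_num)
  obtain ⟨L, hL⟩ := cauchySeq_tendsto_of_complete hcau
  refine ⟨L, Lp.memLp L, ((Lp.tendsto_Lp_iff_tendsto_eLpNorm' _ _).1 hL).congr fun N => ?_⟩
  exact eLpNorm_congr_ae ((ha N).coeFn_toLp.sub .rfl)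

end ConvergesInL2

/-! ### Dependence on the first function -/

section FirstFunction

variable {d k : ℕ} {X : Type u} [MeasurableSpace X] {μ : Measure X}

theorem multipleAverage_congr_ae {T : Fin d → X ≃ᵐ X} (hT : IsCommutingSystem μ T)
    {f f' : Fin d → X → ℂ} (h : ∀ i, f i =ᵐ[μ] f' i) (N : ℕ) :
    multipleAverage T f N =ᵐ[μ] multipleAverage T f' N := by
  have : ∀ᵐ x ∂μ, ∀ (n : ℕ) (i : Fin d), f i ((T i)^[n] x) = f' i ((T i)^[n] x) :=
    ae_all_iff.2 fun n => ae_all_iff.2 fun i =>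
      ((hT.measurePreserving i).iterate n).quasiMeasurePreserving.ae_eq_comp (h i)
  filter_upwards [this] with x hx
  simp only [multipleAverage, hx]

theorem multipleAverage_cons_apply (T : Fin (k + 1) → X ≃ᵐ X) (φ : X → ℂ) (f : Fin k → X → ℂ)
    (N : ℕ) (x : X) : multipleAverage T (Fin.cons φ f) N x = (1 / (N : ℂ)) *
      ∑ n ∈ Finset.Icc 1 N, φ ((T 0)^[n] x) * ∏ i, f i ((T (Fin.succ i))^[n] x) := by
  simp [multipleAverage, Fin.prod_univ_succ]

theorem multipleAverage_cons_add (T : Fin (k + 1) → X ≃ᵐ X) (φ ψ : X → ℂ) (f : Fin k → X → ℂ)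
    (N : ℕ) : multipleAverage T (Fin.cons (φ + ψ) f) N =
      multipleAverage T (Fin.cons φ f) N + multipleAverage T (Fin.cons ψ f) N := by
  ext x
  simp [multipleAverage_cons_apply, add_mul, Finset.sum_add_distrib, mul_add]

theorem multipleAverage_cons_const_mul (T : Fin (k + 1) → X ≃ᵐ X) (c : ℂ) (φ : X → ℂ)
    (f : Fin k → X → ℂ) (N : ℕ) : multipleAverage T (Fin.cons (fun x => c * φ x) f) N =
      (fun _ => c) * multipleAverage T (Fin.cons φ f) N := by
  ext x
  simp only [multipleAverage_cons_apply, Pi.mul_apply, mul_assoc, ← Finset.mul_sum]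
  ring

theorem multipleAverage_cons_sub (T : Fin (k + 1) → X ≃ᵐ X) (φ ψ : X → ℂ) (f : Fin k → X → ℂ)
    (N : ℕ) : multipleAverage T (Fin.cons (φ - ψ) f) N =
      multipleAverage T (Fin.cons φ f) N - multipleAverage T (Fin.cons ψ f) N := by
  ext x
  simp [multipleAverage_cons_apply, sub_mul, Finset.sum_sub_distrib, mul_sub]

variable {T : Fin (k + 1) → X ≃ᵐ X} {f : Fin k → X → ℂ} {C : ℝ}

theorem aestronglyMeasurable_multipleAverage_cons (hT : IsCommutingSystem μ T)
    (hf : ∀ i, Measurable (f i)) {φ : X → ℂ} (hφ : AEStronglyMeasurable φ μ) (N : ℕ) :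
    AEStronglyMeasurable (multipleAverage T (Fin.cons φ f) N) μ := by
  refine ((Measurable.multipleAverage (T := T) (f := Fin.cons (hφ.mk φ) f) (fun i => ?_)
    N).aestronglyMeasurable).congr (multipleAverage_congr_ae hT (fun i => ?_) N)
  · induction i using Fin.cases with
    | zero => exact hφ.stronglyMeasurable_mk.measurable
    | succ j => exact hf j
  · induction i using Fin.cases with
    | zero => exact hφ.ae_eq_mk.symm
    | succ j => exact .rfl

/-- Since T 0 preserves μ, every summand satisfies the bound. Its uniformity in N is what allows
L²-approximation of the first function. -/
theorem eLpNorm_multipleAverage_cons_le (hT : IsCommutingSystem μ T) (hf : ∀ i, Measurable (f i))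
    (hfC : ∀ i x, ‖f i x‖ ≤ C) {φ : X → ℂ} (hφ : AEStronglyMeasurable φ μ) (N : ℕ) :
    eLpNorm (multipleAverage T (Fin.cons φ f) N) 2 μ ≤ ENNReal.ofReal (C ^ k) * eLpNorm φ 2 μ := by
  set F : ℕ → X → ℂ := fun n x => φ ((T 0)^[n] x) * ∏ i, f i ((T (Fin.succ i))^[n] x)
  have hmp : ∀ n, MeasurePreserving ((T 0)^[n]) μ μ := fun n => (hT.measurePreserving 0).iterate n
  have hF : ∀ n, eLpNorm (F n) 2 μ ≤ ENNReal.ofReal (C ^ k) * eLpNorm φ 2 μ := fun n => by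
    rw [← eLpNorm_comp_measurePreserving hφ (hmp n)]
    refine eLpNorm_le_mul_eLpNorm_of_ae_le_mul (ae_of_all _ fun x => ?_) 2
    rw [norm_mul, mul_comm, norm_prod]
    refine mul_le_mul_of_nonneg_right ?_ (norm_nonneg _)
    exact (Finset.prod_le_prod (fun i _ => norm_nonneg _) fun i _ => hfC i _).trans (by simp)
  have hFm : ∀ n, AEStronglyMeasurable (F n) μ := fun n =>
    (hφ.comp_measurePreserving (hmp n)).mul (Finset.measurable_prod _ fun i _ =>
      (hf i).comp ((T (Fin.succ i)).measurable.iterate n)).aestronglyMeasurable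
  have heq : multipleAverage T (Fin.cons φ f) N = (1 / (N : ℂ)) • ∑ n ∈ Finset.Icc 1 N, F n := by
    ext x
    simp [multipleAverage_cons_apply, F]
  rw [heq, eLpNorm_const_smul]
  calc _ ≤ ‖1 / (N : ℂ)‖ₑ * ∑ n ∈ Finset.Icc 1 N, eLpNorm (F n) 2 μ := by
        gcongr
        exact eLpNorm_sum_le (fun n _ => hFm n) (by norm_num)
    _ ≤ ‖1 / (N : ℂ)‖ₑ * (N * (ENNReal.ofReal (C ^ k) * eLpNorm φ 2 μ)) := by
        gcongr
        exact (Finset.sum_le_sum fun n _ => hF n).trans (by simp)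
    _ = ‖1 / (N : ℂ) * N‖ₑ * (ENNReal.ofReal (C ^ k) * eLpNorm φ 2 μ) := by
        rw [enorm_mul, mul_assoc]
        congr 2
        simp [enorm_eq_nnnorm]
    _ ≤ 1 * (ENNReal.ofReal (C ^ k) * eLpNorm φ 2 μ) := by
        gcongr
        by_cases hN : (N : ℂ) = 0
        · simp [hN]
        · simp [hN]
    _ = _ := one_mul _

theorem memLp_multipleAverage_cons (hT : IsCommutingSystem μ T) (hf : ∀ i, Measurable (f i))
    (hfC : ∀ i x, ‖f i x‖ ≤ C) {φ : X → ℂ} (hφ : MemLp φ 2 μ) (N : ℕ) :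
    MemLp (multipleAverage T (Fin.cons φ f) N) 2 μ :=
  ⟨aestronglyMeasurable_multipleAverage_cons hT hf hφ.1 N,
    (eLpNorm_multipleAverage_cons_le hT hf hfC hφ.1 N).trans_lt
      (ENNReal.mul_lt_top ENNReal.ofReal_lt_top hφ.2)⟩

/-- The first functions for which the multiple averages converge form an `L²`-closed set. -/
theorem convergesInL2_cons_of_approx (hT : IsCommutingSystem μ T) (hf : ∀ i, Measurable (f i))
    (hfC : ∀ i x, ‖f i x‖ ≤ C) {φ : X → ℂ} (hφ : MemLp φ 2 μ)
    (h : ∀ ε : ℝ≥0∞, 0 < ε → ∃ ψ : X → ℂ, MemLp ψ 2 μ ∧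
      ConvergesInL2 μ (multipleAverage T (Fin.cons ψ f)) ∧ eLpNorm (φ - ψ) 2 μ ≤ ε) :
    ConvergesInL2 μ (multipleAverage T (Fin.cons φ f)) := by
  refine .of_approx (memLp_multipleAverage_cons hT hf hfC hφ) fun ε hε => ?_
  -- The added 1 keeps the divisor nonzero.
  obtain ⟨ψ, hψ, hconv, hle⟩ := h (ε / (ENNReal.ofReal (C ^ k) + 1))
    (ENNReal.div_pos hε.ne' (by finiteness))
  refine ⟨_, hconv, aestronglyMeasurable_multipleAverage_cons hT hf hψ.1, fun N => ?_⟩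
  rw [← multipleAverage_cons_sub]
  calc _ ≤ ENNReal.ofReal (C ^ k) * eLpNorm (φ - ψ) 2 μ :=
        eLpNorm_multipleAverage_cons_le hT hf hfC (hφ.1.sub hψ.1) N
    _ ≤ (ENNReal.ofReal (C ^ k) + 1) * (ε / (ENNReal.ofReal (C ^ k) + 1)) := by
        gcongr
        exact le_self_add
    _ ≤ ε := ENNReal.mul_div_le

end FirstFunction

/-! ### First functions measurable over the largest 𝒞-factor -/

section Isotropy

variable {k : ℕ} {X : Type u} [MeasurableSpace X] {μ : Measure X} {T : Fin (k + 1) → X ≃ᵐ X}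

theorem ae_mem_iff_of_isotropy {S : X → X} {B : Set X} (hB : MeasurableSet[isotropy μ S] B) :
    ∀ᵐ x ∂μ, S x ∈ B ↔ x ∈ B := by
  have h := measure_symmDiff_eq_zero_iff.1 hB.2
  filter_upwards [Filter.eventuallyEq_set.1 h] with x hx using hx.symm

theorem ae_iterate_mem_iff_of_isotropy {S : X → X} (hS : MeasurePreserving S μ μ) {B : Set X}
    (hB : MeasurableSet[isotropy μ S] B) (n : ℕ) : ∀ᵐ x ∂μ, S^[n] x ∈ B ↔ x ∈ B := by
  induction n with
  | zero => simp
  | succ n ih =>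
    filter_upwards [ih, (hS.iterate n).quasiMeasurePreserving.ae (ae_mem_iff_of_isotropy hB)]
      with x h1 h2
    rw [Function.iterate_succ_apply', h2, h1]

/-- Invariance of B under T_j T_0⁻¹ says that T_j⁻¹ B and T_0⁻¹ B agree up to a null set. By
commutation the factors T_0 can be exchanged for T_j one at a time. -/
theorem ae_iterate_mem_iff_iterate_mem (hT : IsCommutingSystem μ T) (j : Fin (k + 1)) {B : Set X}
    (hB : MeasurableSet[isotropy μ fun x => T j ((T 0).symm x)] B) (n : ℕ) :
    ∀ᵐ x ∂μ, (T 0)^[n] x ∈ B ↔ (T j)^[n] x ∈ B := by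
  have h1 : ∀ᵐ x ∂μ, T j x ∈ B ↔ T 0 x ∈ B := by
    filter_upwards [(hT.measurePreserving 0).quasiMeasurePreserving.ae (ae_mem_iff_of_isotropy hB)]
      with x hx
    simpa using hx
  induction n with
  | zero => simp
  | succ n ih =>
    filter_upwards [(hT.measurePreserving j).quasiMeasurePreserving.ae ih,
      ((hT.measurePreserving 0).iterate n).quasiMeasurePreserving.ae h1] with x h2 h3
    rw [Function.iterate_succ_apply', ← h3, ← iterate_apply_comm hT.commute 0 j, h2,
      Function.iterate_succ_apply]

/-- The isotropy σ-algebras whose join is the largest `𝒞`-factor. -/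
@[reducible]
def cFactorComponent (μ : Measure X) (T : Fin (k + 1) → X ≃ᵐ X) (i : Fin (k + 1)) :
    MeasurableSpace X :=
  Fin.cases (isotropy μ (T 0)) (fun j => isotropy μ fun x => T j.succ ((T 0).symm x)) i

theorem largestCFactor_eq_iSup : largestCFactor μ T = ⨆ i ∈ Set.univ, cFactorComponent μ T i := by
  simp only [Set.mem_univ, iSup_pos]
  refine le_antisymm (sup_le (le_iSup (cFactorComponent μ T) 0) (iSup₂_le fun i hi => ?_))
    (iSup_le fun i => ?_)
  · obtain ⟨j, rfl⟩ := Fin.exists_succ_eq.2 hi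
    exact le_iSup (cFactorComponent μ T) j.succ
  · induction i using Fin.cases with
    | zero => exact le_sup_left
    | succ j => exact le_sup_of_le_right (le_iSup₂_of_le j.succ (Fin.succ_ne_zero j) le_rfl)

variable {f : Fin k → X → ℂ} {C : ℝ}

theorem convergesInL2_cons_const_mul (c : ℂ) {φ : X → ℂ}
    (h : ConvergesInL2 μ (multipleAverage T (Fin.cons φ f))) :
    ConvergesInL2 μ (multipleAverage T (Fin.cons (fun x => c * φ x) f)) := by
  refine (h.bdd_mul (h := fun _ => c) aestronglyMeasurable_const (C := ‖c‖) (by simp)).congr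
    fun N => ?_
  rw [multipleAverage_cons_const_mul]

theorem convergesInL2_cons_add (hT : IsCommutingSystem μ T) (hf : ∀ i, Measurable (f i))
    {φ ψ : X → ℂ} (hφ : AEStronglyMeasurable φ μ) (hψ : AEStronglyMeasurable ψ μ)
    (h : ConvergesInL2 μ (multipleAverage T (Fin.cons φ f)))
    (h' : ConvergesInL2 μ (multipleAverage T (Fin.cons ψ f))) :
    ConvergesInL2 μ (multipleAverage T (Fin.cons (φ + ψ) f)) := by
  refine (h.add h' (aestronglyMeasurable_multipleAverage_cons hT hf hφ)
    (aestronglyMeasurable_multipleAverage_cons hT hf hψ)).congr fun N => ?_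
  rw [multipleAverage_cons_add]

theorem convergesInL2_cons_congr (hT : IsCommutingSystem μ T) {φ ψ : X → ℂ} (hφψ : φ =ᵐ[μ] ψ)
    (h : ConvergesInL2 μ (multipleAverage T (Fin.cons φ f))) :
    ConvergesInL2 μ (multipleAverage T (Fin.cons ψ f)) := by
  refine h.congr (multipleAverage_congr_ae hT fun i => ?_)
  induction i using Fin.cases with
  | zero => exact hφψ
  | succ j => exact .rfl

/-- The indicator of B 0 is invariant under T 0 and leaves the average. The indicator of B j.succ
has the same iterates under T 0 and T j.succ, so it is absorbed into f j. The average for the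
remaining k transformations is left. -/
theorem convergesInL2_cons_prod_indicator [IsFiniteMeasure μ] (hT : IsCommutingSystem μ T)
    (hconv : MultipleAveragesConverge μ fun j : Fin k => T j.succ) (hf : ∀ i, Measurable (f i))
    (hfC : ∀ i x, ‖f i x‖ ≤ C) {B : Fin (k + 1) → Set X}
    (hB : ∀ i, MeasurableSet[cFactorComponent μ T i] (B i)) :
    ConvergesInL2 μ (multipleAverage T
      (Fin.cons (fun x => ∏ i, (B i).indicator (fun _ => (1 : ℂ)) x) f)) := by
  have hBm : ∀ i, MeasurableSet (B i) := fun i => by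
    induction i using Fin.cases with
    | zero => exact isotropy_le _ _ _ (hB 0)
    | succ j => exact isotropy_le _ _ _ (hB j.succ)
  have h1 : ∀ (s : Set X) (x : X), ‖s.indicator (fun _ => (1 : ℂ)) x‖ ≤ 1 := fun s x =>
    (norm_indicator_le_norm_self _ _).trans (by simp)
  have hbase : ConvergesInL2 μ (multipleAverage (fun j : Fin k => T j.succ)
      fun j x => (B j.succ).indicator (fun _ => (1 : ℂ)) x * f j x) :=
    hconv _ fun j => .of_bound
      (((measurable_const.indicator (hBm j.succ)).mul (hf j)).aestronglyMeasurable) C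
      (ae_of_all _ fun x => by
        rw [norm_mul]
        exact (mul_le_mul (h1 _ x) (hfC j x) (norm_nonneg _) zero_le_one).trans (by simp))
  refine (hbase.bdd_mul (h := (B 0).indicator fun _ => (1 : ℂ))
    (measurable_const.indicator (hBm 0)).aestronglyMeasurable (h1 _)).congr fun N => ?_
  have h0 : ∀ᵐ x ∂μ, ∀ n, (T 0)^[n] x ∈ B 0 ↔ x ∈ B 0 :=
    ae_all_iff.2 (ae_iterate_mem_iff_of_isotropy (hT.measurePreserving 0) (hB 0))
  have hj : ∀ᵐ x ∂μ, ∀ (n : ℕ) (j : Fin k),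
      (T 0)^[n] x ∈ B j.succ ↔ (T j.succ)^[n] x ∈ B j.succ :=
    ae_all_iff.2 fun n => ae_all_iff.2 fun j =>
      ae_iterate_mem_iff_iterate_mem hT j.succ (hB j.succ) n
  filter_upwards [h0, hj] with x hx0 hxj
  classical
  rw [multipleAverage_cons_apply, Pi.mul_apply, multipleAverage, mul_left_comm, Finset.mul_sum]
  congr 1
  refine Finset.sum_congr rfl fun n _ => ?_
  simp only [Fin.prod_univ_succ, Set.indicator_apply, hx0, hxj, Finset.prod_mul_distrib, mul_assoc]

/-- A π-λ argument: finite intersections of sets from the components generate the factor,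
complements follow by linearity, and countable disjoint unions by L²-approximation. -/
theorem convergesInL2_cons_indicator [IsProbabilityMeasure μ] (hT : IsCommutingSystem μ T)
    (hconv : MultipleAveragesConverge μ fun j : Fin k => T j.succ) (hf : ∀ i, Measurable (f i))
    (hfC : ∀ i x, ‖f i x‖ ≤ C) {A : Set X} (hA : MeasurableSet[largestCFactor μ T] A) :
    ConvergesInL2 μ (multipleAverage T (Fin.cons (A.indicator fun _ => (1 : ℂ)) f)) := by
  have hle := largestCFactor_le μ T
  have hLp : ∀ {A : Set X}, MeasurableSet[largestCFactor μ T] A →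
      MemLp (A.indicator fun _ => (1 : ℂ)) 2 μ := fun hA =>
    (memLp_const 1).indicator (hle _ hA)
  have hpi : IsPiSystem (piiUnionInter
      (fun i => {s | MeasurableSet[cFactorComponent μ T i] s}) Set.univ) :=
    isPiSystem_piiUnionInter _ (fun i => @MeasurableSpace.isPiSystem_measurableSet _
      (cFactorComponent μ T i)) _
  have hbasic : ∀ B : Fin (k + 1) → Set X, (∀ i, MeasurableSet[cFactorComponent μ T i] (B i)) →
      ConvergesInL2 μ (multipleAverage T (Fin.cons ((⋂ i, B i).indicator fun _ => (1 : ℂ)) f)) := by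
    intro B hB
    have heq : ((⋂ i, B i).indicator fun _ => (1 : ℂ)) =
        fun x => ∏ i, (B i).indicator (fun _ => (1 : ℂ)) x := by
      classical
      ext x
      simp [Set.indicator_apply, Finset.prod_ite_zero]
    rw [heq]
    exact convergesInL2_cons_prod_indicator hT hconv hf hfC hB
  have huniv : ConvergesInL2 μ
      (multipleAverage T (Fin.cons (Set.univ.indicator fun _ => (1 : ℂ)) f)) := by
    simpa using hbasic (fun _ => Set.univ) fun i => @MeasurableSet.univ _ (cFactorComponent μ T i)
  induction A, hA using MeasurableSpace.induction_on_inter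
    (largestCFactor_eq_iSup.trans (generateFrom_piiUnionInter_measurableSet _ _).symm) hpi with
  | empty =>
    refine huniv.bdd_mul (h := 0) aestronglyMeasurable_zero (C := 0) (by simp) |>.congr
      fun N => .of_forall fun x => ?_
    simp [multipleAverage_cons_apply]
  | basic A hA =>
    obtain ⟨t, -, B, hB, rfl⟩ := hA
    classical
    -- Components absent from the finite intersection contribute the whole space.
    have := hbasic (fun i => if i ∈ t then B i else Set.univ) fun i => by
      by_cases hi : i ∈ t
      · simpa [hi] using hB i hi
      · simp [hi]
    convert! this using 4
    ext x
    simp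
  | compl A hA ih =>
    have hAm := (hLp hA).1
    convert! convergesInL2_cons_add hT hf (hLp (A := Set.univ) MeasurableSet.univ).1 (hAm.const_mul (-1)) huniv
      (convergesInL2_cons_const_mul (-1) ih) using 3
    ext x
    by_cases hx : x ∈ A <;> simp [hx]
  | iUnion A hdisj hA ih =>
    have hAm : ∀ i, MeasurableSet (A i) := fun i => hle _ (hA i)
    have hAcc : ∀ n, MeasurableSet[largestCFactor μ T] (Set.accumulate A n) := fun n =>
      MeasurableSet.biUnion (Set.to_countable _) fun i _ => hA i
    have hP : ∀ n, ConvergesInL2 μ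
        (multipleAverage T (Fin.cons ((Set.accumulate A n).indicator fun _ => (1 : ℂ)) f)) := by
      intro n
      induction n with
      | zero => simpa using ih 0
      | succ n ihn =>
        rw [Set.accumulate_succ, Set.indicator_union_of_disjoint
          (Set.disjoint_accumulate hdisj (Nat.lt_succ_self n))]
        exact convergesInL2_cons_add hT hf (hLp (hAcc n)).1 (hLp (hA (n + 1))).1 ihn (ih (n + 1))
    refine convergesInL2_cons_of_approx hT hf hfC (hLp (MeasurableSet.iUnion hA)) fun ε hε => ?_
    -- A set of measure at most η has an indicator of L² norm at most ε. The tail of the union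
    -- beyond a large partial union is such a set.
    obtain ⟨η, hη, hηε⟩ := exists_eLpNorm_indicator_le (μ := μ) (p := 2) (by simp) (1 : ℂ) hε.ne'
    have hlim := tendsto_measure_iUnion_accumulate (μ := μ) (f := A)
    have hlim2 : Tendsto (fun n => μ (⋃ i, A i) - μ (Set.accumulate A n)) atTop (𝓝 0) := by
      simpa using ENNReal.Tendsto.sub tendsto_const_nhds hlim (.inl (measure_ne_top μ (⋃ i, A i)))
    obtain ⟨n, hn⟩ := (hlim2.eventually (gt_mem_nhds (ENNReal.coe_pos.2 hη))).exists
    refine ⟨_, hLp (hAcc n), hP n, ?_⟩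
    have hsub : Set.accumulate A n ⊆ ⋃ i, A i := Set.accumulate_subset_iUnion n
    rw [← Set.indicator_sdiff hsub]
    refine hηε _ ?_
    rw [measure_sdiff hsub (hle _ (hAcc n)).nullMeasurableSet (measure_ne_top _ _)]
    exact hn.le

/-- Indicators extend to all L² functions on the factor by linearity and closedness. -/
theorem convergesInL2_cons_of_stronglyMeasurable [IsProbabilityMeasure μ]
    (hT : IsCommutingSystem μ T)
    (hconv : MultipleAveragesConverge μ fun j : Fin k => T j.succ) (hf : ∀ i, Measurable (f i))
    (hfC : ∀ i x, ‖f i x‖ ≤ C) {φ : X → ℂ} (hφ : StronglyMeasurable[largestCFactor μ T] φ)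
    (hφ2 : MemLp φ 2 μ) :
    ConvergesInL2 μ (multipleAverage T (Fin.cons φ f)) := by
  refine MemLp.induction_stronglyMeasurable (largestCFactor_le μ T) (p := 2) (by simp)
    (fun φ => ConvergesInL2 μ (multipleAverage T (Fin.cons φ f))) ?_ ?_ ?_ ?_ hφ2
    hφ.aestronglyMeasurable
  · intro c A hA _
    convert! convergesInL2_cons_const_mul c (convergesInL2_cons_indicator hT hconv hf hfC hA) using 3
    ext x
    by_cases hx : x ∈ A <;> simp [hx]
  · exact fun φ ψ _ hφ hψ _ _ => convergesInL2_cons_add hT hf hφ.1 hψ.1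
  · refine isClosed_of_closure_subset fun φ hφ => ?_
    refine convergesInL2_cons_of_approx hT hf hfC (Lp.memLp _) fun ε hε => ?_
    obtain ⟨ψ, hψ, hdist⟩ := EMetric.mem_closure_iff.1 hφ ε hε
    refine ⟨_, Lp.memLp _, hψ, ?_⟩
    rw [← Lp.edist_def]
    exact hdist.le
  · exact fun φ ψ h _ => convergesInL2_cons_congr hT h

end Isotropy

/-! ### Splitting the first function and conclusion -/

section Main

variable {X : Type u} [MeasurableSpace X] {μ : Measure X}

/-- An essentially bounded function agrees almost everywhere with a bounded measurable one. -/
theorem exists_bounded_measurable_ae_eq {f : X → ℂ} (hf : MemLp f ∞ μ) :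
    ∃ C : ℝ, 0 ≤ C ∧ ∃ g : X → ℂ, Measurable g ∧ f =ᵐ[μ] g ∧ ∀ x, ‖g x‖ ≤ C := by
  have hbd := ae_le_lpNorm_exponent_top hf
  have hsm : AEStronglyMeasurable f μ := hf.1
  set C := lpNorm f ∞ μ
  have hm := hsm.stronglyMeasurable_mk.measurable
  have hC : 0 ≤ C := lpNorm_nonneg
  refine ⟨C, hC, Set.indicator {x | ‖hsm.mk f x‖ ≤ C} (hsm.mk f),
    hm.indicator (measurableSet_le hm.norm measurable_const), ?_, fun x => ?_⟩
  · filter_upwards [hbd, hsm.ae_eq_mk] with x hx heq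
    rw [heq] at hx ⊢
    exact (Set.indicator_of_mem (s := {x | ‖hsm.mk f x‖ ≤ C}) hx _).symm
  · by_cases hx : x ∈ {x | ‖hsm.mk f x‖ ≤ C}
    · rw [Set.indicator_of_mem hx]
      exact hx
    · rw [Set.indicator_of_notMem hx]
      simpa using hC

/-- Convergence of multiple averages with a bounded measurable first function in a `𝒞`-sated
system. -/
theorem IsCSated.convergesInL2_cons [StandardBorelSpace X] [IsProbabilityMeasure μ] {k : ℕ}
    {T : Fin (k + 1) → X ≃ᵐ X} (hs : IsCSated μ T) (hT : IsCommutingSystem μ T)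
    (hconv : MultipleAveragesConverge μ fun j : Fin k => T j.succ) {f : Fin k → X → ℂ}
    (hf : ∀ i, Measurable (f i)) {C : ℝ} (hC : 0 ≤ C) (hfC : ∀ i x, ‖f i x‖ ≤ C) {φ : X → ℂ}
    (hφ : Measurable φ) (hφC : ∀ x, ‖φ x‖ ≤ C) :
    ConvergesInL2 μ (multipleAverage T (Fin.cons φ f)) := by
  have hle := largestCFactor_le μ T
  set g₀ := μ[φ | largestCFactor μ T]
  have hg₀ : StronglyMeasurable[largestCFactor μ T] g₀ := stronglyMeasurable_condExp
  have hg₀C : ∀ᵐ x ∂μ, ‖g₀ x‖ ≤ C := ae_bdd_norm_condExp_of_ae_bdd_norm (ae_of_all _ hφC)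
  -- The conditional expectation is bounded by C only almost everywhere. Cutting it off on a set of
  -- the factor gives a version that is bounded everywhere and still measurable over the factor.
  set s := {x | ‖g₀ x‖ ≤ C}
  have hsm : MeasurableSet[largestCFactor μ T] s :=
    hg₀.norm.measurableSet_le stronglyMeasurable_const
  set g := s.indicator g₀
  have hg : StronglyMeasurable[largestCFactor μ T] g := hg₀.indicator hsm
  have hgC : ∀ x, ‖g x‖ ≤ C := fun x => by
    by_cases hx : x ∈ s
    · rw [show g x = g₀ x from Set.indicator_of_mem hx _]
      exact hx
    · simpa [g, hx] using hC
  have hgg₀ : g =ᵐ[μ] g₀ := by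
    filter_upwards [hg₀C] with x hx using Set.indicator_of_mem (show x ∈ s from hx) _
  have hgm : Measurable g := (hg.mono hle).measurable
  have hφi : Integrable φ μ := .of_bound hφ.aestronglyMeasurable C (ae_of_all _ hφC)
  have hgi : Integrable g μ := .of_bound hgm.aestronglyMeasurable C (ae_of_all _ hgC)
  have hzero : μ[φ - g | largestCFactor μ T] =ᵐ[μ] 0 := by
    refine (condExp_sub hφi hgi _).trans ?_
    rw [condExp_of_stronglyMeasurable hle hg hgi]
    filter_upwards [hgg₀] with x hx
    simp [hx, g₀]
  have hvan := hs.tendsto_eLpNorm_multipleAverage hT (f := Fin.cons (φ - g) f) (C := 2 * C)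
    (fun i => by
      induction i using Fin.cases with
      | zero => exact hφ.sub hgm
      | succ j => exact hf j)
    (by positivity)
    (fun i x => by
      induction i using Fin.cases with
      | zero => exact (norm_sub_le _ _).trans (by linarith [hφC x, hgC x])
      | succ j => exact (hfC j x).trans (by linarith))
    hzero
  have h1 : ConvergesInL2 μ (multipleAverage T (Fin.cons (φ - g) f)) :=
    ⟨0, MemLp.zero, by simpa using hvan⟩
  have h2 := convergesInL2_cons_of_stronglyMeasurable hT hconv hf hfC hg
    (.of_bound hgm.aestronglyMeasurable C (ae_of_all _ hgC))
  have h3 := convergesInL2_cons_add hT hf (hφ.sub hgm).aestronglyMeasurable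
    hgm.aestronglyMeasurable h1 h2
  rwa [sub_add_cancel] at h3

end Main

theorem mainTheorem5 (d : ℕ) [NeZero d] (hd : 2 ≤ d) (hind : MultipleErgodicTheorem.{u} (d - 1))
    (X : Type u) [MeasurableSpace X] [StandardBorelSpace X]
    (μ : Measure X) [IsProbabilityMeasure μ] (T : Fin d → X ≃ᵐ X)
    (hT : IsCommutingSystem μ T) (hsated : IsCSated μ T) :
    MultipleAveragesConverge μ T := by
  obtain ⟨k, rfl⟩ : ∃ k, d = k + 1 := ⟨d - 1, by omega⟩
  have hconv : MultipleAveragesConverge μ fun j : Fin k => T j.succ :=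
    hind X μ _ ⟨fun j => hT.measurePreserving j.succ, fun i j => hT.commute i.succ j.succ⟩
  intro f hf
  choose C hC g hg hfg hgC using fun i => exists_bounded_measurable_ae_eq (hf i)
  -- The sum serves as one common bound for all the functions.
  have hle : ∀ i, C i ≤ ∑ j, C j := fun i =>
    Finset.single_le_sum (fun j _ => hC j) (Finset.mem_univ i)
  have key : ConvergesInL2 μ (multipleAverage T (Fin.cons (g 0) fun j => g j.succ)) :=
    hsated.convergesInL2_cons hT hconv (fun i => hg i.succ)
      (Finset.sum_nonneg fun j _ => hC j) (fun i x => (hgC i.succ x).trans (hle i.succ)) (hg 0)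
      fun x => (hgC 0 x).trans (hle 0)
  have hcons : (Fin.cons (g 0) fun j => g j.succ : Fin (k + 1) → X → ℂ) = g :=
    Fin.cons_self_tail g
  rw [hcons] at key
  exact key.congr fun N => (multipleAverage_congr_ae hT hfg N).symm
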